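/- Let $N$ be a positive integer. For $\mathbf v=(v_0,\dots,v_N)\in\mathbb C^{N+1}$ let $$p_{\mathbf v}(x)=v_0+\sum_{n=1}^N v_n\,(x^n+x^{-n}),\qquad \mu_{\mathrm{rec}}(\mathbf v)=\exp\left\{\int_0^1\log\left|p_{\mathbf v}(e^{2\pi i t})\right|\,dt\right\},$$ with $\mu_{\mathrm{rec}}(\mathbf 0)=0$, and let $$\mathcal V_{N+1}=\{\mathbf v\in\mathbb C^{N+1}:\ \mu_{\mathrm{rec}}(\mathbf v)\le 1\}.$$ Let $\lambda_{2N+2}$ denote Lebesgue measure on the Borel subsets of $\mathbb C^{N+1}\cong\mathbb R^{2N+2}$. Then $\mathcal V_{N+1}$ is a Borel set and $$\lambda_{2N+2}(\mathcal V_{N+1})=\frac{2^N\,\pi^{N+1}\,(N+1)^N}{(2N+1)!}.$$ In particular, identify the space of polynomials $f(x)=\sum_{m=0}^{2N}w_mx^m\in\mathbb C[x]$ with $w_m=w_{2N-m}$ for $0\le m\le 2N$ (the reciprocal polynomials of formal degree $2N$) with $\mathbb C^{N+1}$ through the coordinates $(w_N,w_{N+1},\dots,w_{2N})$. Then the $\lambda_{2N+2}$-volume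 of the set of such $f$ with Mahler measure $\mu(f)=\exp\{\int_0^1\log|f(e^{2\pi i t})|\,dt\}$ at most one (where $\mu(0)=0$) is a positive rational multiple of a power $\pi^k$ of $\pi$ with $k$ a nonnegative integer. -/

import Mathlib

open MeasureTheory

noncomputable section

/-- The reciprocal Laurent polynomial `p_v(x) = v₀ + ∑_{n=1}^N vₙ (xⁿ + x⁻ⁿ)` with coefficient
vector `v ∈ ℂ^{N+1}`, as a function of `x`. -/
def recLaurent {N : ℕ} (v : Fin (N + 1) → ℂ) (x : ℂ) : ℂ :=
  v 0 + ∑ n : Fin N, v n.succ * (x ^ ((n : ℕ) + 1) + (x⁻¹) ^ ((n : ℕ) + 1))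

/-- The reciprocal Mahler measure
`μ_rec(v) = exp (∫₀¹ log |p_v(e^{2πit})| dt)`, with the usual convention that it is `0` at `v = 0`
(where the integrand is constantly `-∞`). -/
def recMahlerMeasure {N : ℕ} (v : Fin (N + 1) → ℂ) : ℝ :=
  open Classical in
  if v = 0 then 0
  else Real.exp (∫ t in (0 : ℝ)..1,
    Real.log ‖recLaurent v (Complex.exp (2 * Real.pi * Complex.I * t))‖)

/-- The complex star body `V_{N+1} = {v ∈ ℂ^{N+1} : μ_rec(v) ≤ 1}`. -/
def recStarBody (N : ℕ) : Set (Fin (N + 1) → ℂ) :=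
  {v | recMahlerMeasure v ≤ 1}

/-- The reciprocal polynomials of formal degree `2N`, i.e. the polynomials
`f = ∑_{m=0}^{2N} w_m x^m` with `w_m = w_{2N-m}`. -/
def reciprocalPolynomials (N : ℕ) : Set (Polynomial ℂ) :=
  {f | f.natDegree ≤ 2 * N ∧ ∀ m ≤ 2 * N, f.coeff m = f.coeff (2 * N - m)}

/-- The linear coordinates `(w_N, w_{N+1}, …, w_{2N}) ∈ ℂ^{N+1}` of a polynomial
`f = ∑ w_m x^m`; on the reciprocal polynomials of formal degree `2N` they
are the `v` with `f(x) = x^N p_v(x)`. -/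
def reciprocalCoords (N : ℕ) (f : Polynomial ℂ) : Fin (N + 1) → ℂ :=
  fun n => f.coeff (N + n)

end

/-!
Write `p_v(x) = q(x + x⁻¹)`. Since `xⁿ + x⁻ⁿ` is a monic Chebyshev polynomial of degree `n` in
`x + x⁻¹`, the passage from `v` to the coefficients of `q` is a unipotent linear map, so it
preserves volume (`volume_recStarBody_eq_volume_coeffHeight_le`). Split `q = a (X^N + ∑ b_k X^k)`.
The reciprocal Mahler measure is `|a|` times a function `monicHeight b`, and integrating out `a`
leaves `π/(N+1) ∫ (monicHeight b)^(-2(N+1)) db` (`volume_coeffHeight_le`).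

In terms of the roots `β₁, …, β_N` the function `monicHeight` is a product of factors
`rootHeight (βᵢ)`, and `db` becomes `|det V|²/N! dβ` for the Vandermonde matrix `V`
(`factorial_mul_lintegral_eq_lintegral_roots`). The map from roots to coefficients is injective on
each of the `N!` regions where the real parts of the roots are strictly ordered in a given way, and
its image there is conull.

The resulting integral is computed by Andréief's identity (`lintegral_norm_det_sq`) from a family
of monic polynomials orthogonal for the weight `rootHeight(β)^(-2(N+1))` on `ℂ`. These are the
Chebyshev polynomials `S n`, with `S n (γ + γ⁻¹) = (γ^(n+1) - γ^(-n-1)) / (γ - γ⁻¹)`. Indeed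
`γ ↦ γ + γ⁻¹` maps the exterior of the unit disc injectively onto `ℂ` minus a null set,
`rootHeight (γ + γ⁻¹) = |γ|`, and the Jacobian `|1 - γ⁻²|²` cancels the denominators, so only
moments of monomials are left (`integral_weightedChebyshev_mul`). The squared norms are
`2π(N+1) / ((N+1)² - (n+1)²)` for `n < N`, and their product gives the stated value
(`prod_chebyshevNormSq`).

A reciprocal polynomial of formal degree `2N` is `x^N p_v(x)` for its coordinate vector `v`, and
`|x^N| = 1` on the unit circle, so the last assertion concerns the same set
(`image_reciprocalCoords_eq`).
-/

open Polynomial ComplexConjugate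

/-! ### Jacobian of the map from roots to coefficients -/

/-- The map from the roots `β₁, …, β_N` to the non-leading coefficients of `∏ (X - βᵢ)`. -/
noncomputable def coeffsOfRoots {N : ℕ} (β : Fin N → ℂ) : Fin N → ℂ :=
  fun k => (∏ i, (X - C (β i))).coeff k

/-- Moving the root `βᵢ` changes `∏_{i ∈ s} (X - βᵢ)` by `-∏_{j ≠ i} (X - βⱼ)`, coefficient by
coefficient. -/
theorem hasFDerivAt_coeff_prod_X_sub_C {N : ℕ} (s : Finset (Fin N)) (k : ℕ) (β : Fin N → ℂ) :
    HasFDerivAt (𝕜 := ℂ) (fun β : Fin N → ℂ => (∏ i ∈ s, (X - C (β i))).coeff k)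
      (∑ i ∈ s, (-(∏ j ∈ s.erase i, (X - C (β j))).coeff k) •
        ContinuousLinearMap.proj (R := ℂ) (φ := fun _ : Fin N => ℂ) i) β := by
  induction s using Finset.induction_on generalizing k with
  | empty => simpa using hasFDerivAt_const _ _
  | insert a s ha ih =>
    have hpa : HasFDerivAt (𝕜 := ℂ) (fun β : Fin N → ℂ => β a)
      (ContinuousLinearMap.proj (R := ℂ) (φ := fun _ : Fin N => ℂ) a) β :=
      (ContinuousLinearMap.proj (R := ℂ) (φ := fun _ : Fin N => ℂ) a).hasFDerivAt
    have her : ∀ i ∈ s, (insert a s).erase i = insert a (s.erase i) := fun i hi => by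
      rw [Finset.erase_insert_of_ne]; rintro rfl; exact ha hi
    have hna : ∀ i ∈ s, a ∉ s.erase i := fun i hi h => ha (Finset.mem_of_mem_erase h)
    cases k with
    | zero =>
      have h := (hpa.mul (ih 0)).neg
      simp only [Finset.prod_insert ha, mul_coeff_zero, coeff_sub, coeff_X_zero, coeff_C_zero,
        zero_sub, neg_mul]
      refine h.congr_fderiv ?_
      rw [Finset.sum_insert ha, Finset.erase_insert ha, Finset.smul_sum, neg_add, add_comm,
        ← Finset.sum_neg_distrib]
      congr 1
      · exact (neg_smul _ _).symm
      · refine Finset.sum_congr rfl fun i hi => ?_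
        rw [her i hi, Finset.prod_insert (hna i hi), mul_coeff_zero]
        simp only [coeff_sub, coeff_X_zero, coeff_C_zero, zero_sub, neg_mul, smul_smul, neg_neg]
        rw [mul_neg]
        exact (neg_smul _ _).symm.trans (by rw [neg_neg])
    | succ k =>
      have h := (ih k).sub (hpa.mul (ih (k + 1)))
      simp only [Finset.prod_insert ha, sub_mul, coeff_sub, coeff_X_mul, coeff_C_mul]
      refine h.congr_fderiv ?_
      rw [Finset.sum_insert ha, Finset.erase_insert ha, Finset.smul_sum, sub_add_eq_sub_sub,
        ← Finset.sum_sub_distrib, sub_eq_add_neg, add_comm]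
      congr 1
      · exact (neg_smul _ _).symm
      · refine Finset.sum_congr rfl fun i hi => ?_
        rw [her i hi, Finset.prod_insert (hna i hi), sub_mul, coeff_sub, coeff_X_mul, coeff_C_mul,
          smul_smul, ← sub_smul]
        congr 1
        ring

/-- The Jacobian matrix of `coeffsOfRoots`. -/
noncomputable def jacobianCoeffsOfRoots {N : ℕ} (β : Fin N → ℂ) : Matrix (Fin N) (Fin N) ℂ :=
  Matrix.of fun k i => -(∏ j ∈ Finset.univ.erase i, (X - C (β j))).coeff k

theorem hasFDerivAt_coeffsOfRoots {N : ℕ} (β : Fin N → ℂ) :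
    HasFDerivAt (𝕜 := ℂ) coeffsOfRoots
      (LinearMap.toContinuousLinearMap (Matrix.toLin' (jacobianCoeffsOfRoots β))) β := by
  rw [hasFDerivAt_pi']
  intro k
  refine (hasFDerivAt_coeff_prod_X_sub_C Finset.univ k β).congr_fderiv ?_
  ext h
  simp [jacobianCoeffsOfRoots, Matrix.mulVec, dotProduct]

/-- The discriminant form of the Vandermonde determinant: each pair of indices occurs twice. -/
theorem norm_det_vandermonde_sq {N : ℕ} (β : Fin N → ℂ) :
    ∏ i, ∏ j ∈ Finset.univ.erase i, ‖β i - β j‖ = ‖(Matrix.vandermonde β).det‖ ^ 2 := by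
  have hu : ∀ i : Fin N, Finset.univ.erase i = Finset.Ioi i ∪ Finset.Iio i := fun i => by
    ext j; simp [eq_comm]
  have hd : ∀ i : Fin N, Disjoint (Finset.Ioi i) (Finset.Iio i) := fun i => by
    rw [Finset.disjoint_left]; intro j; simp; exact fun h => h.le
  have hs : ∏ i, ∏ j ∈ Finset.Iio i, ‖β i - β j‖ = ∏ i, ∏ j ∈ Finset.Ioi i, ‖β j - β i‖ :=
    Finset.prod_comm' (by simp)
  simp_rw [hu, Finset.prod_union (hd _), Finset.prod_mul_distrib, hs, Matrix.det_vandermonde,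
    norm_prod, sq]
  congr 1
  simp_rw [norm_sub_rev]

/-- Multiplying the Jacobian matrix by the Vandermonde matrix evaluates the polynomials
`∏_{j ≠ i} (X - βⱼ)` at the roots, which gives a diagonal matrix. -/
theorem vandermonde_mul_jacobianCoeffsOfRoots {N : ℕ} (β : Fin N → ℂ) :
    Matrix.vandermonde β * jacobianCoeffsOfRoots β =
      Matrix.diagonal fun i => -∏ j ∈ Finset.univ.erase i, (β i - β j) := by
  ext l i
  have hdeg : (∏ j ∈ Finset.univ.erase i, (X - C (β j))).natDegree < N := by
    rw [natDegree_prod_of_monic _ _ fun j _ => monic_X_sub_C _]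
    simp [Finset.card_erase_of_mem]
    exact Fin.pos i
  have hev : (Matrix.vandermonde β * jacobianCoeffsOfRoots β) l i =
      -(∏ j ∈ Finset.univ.erase i, (X - C (β j))).eval (β l) := by
    rw [eval_eq_sum_range' hdeg, Matrix.mul_apply, Finset.sum_range, ← Finset.sum_neg_distrib]
    refine Finset.sum_congr rfl fun k _ => ?_
    simp [jacobianCoeffsOfRoots, Matrix.vandermonde_apply, mul_comm]
  rw [hev, eval_prod]
  by_cases h : l = i
  · subst h; simp
  · rw [Matrix.diagonal_apply_ne _ h, Finset.prod_eq_zero (i := l)] <;> simp [h]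

/-- At distinct roots the factor `det V` cancels from `|det V| |det J| = |det V|²`. -/
theorem norm_det_jacobianCoeffsOfRoots {N : ℕ} {β : Fin N → ℂ} (hβ : Function.Injective β) :
    ‖(jacobianCoeffsOfRoots β).det‖ = ‖(Matrix.vandermonde β).det‖ := by
  have h := congrArg (fun M => ‖Matrix.det M‖) (vandermonde_mul_jacobianCoeffsOfRoots β)
  simp only [Matrix.det_mul, norm_mul, Matrix.det_diagonal, norm_prod, norm_neg] at h
  rw [norm_det_vandermonde_sq, sq] at h
  exact mul_left_cancel₀ (norm_ne_zero_iff.2 (Matrix.det_vandermonde_ne_zero_iff.2 hβ)) h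

/-- As a real-linear map, a complex matrix has determinant `|det M|²`. -/
theorem det_restrictScalars_toLin' {n : ℕ} (M : Matrix (Fin n) (Fin n) ℂ) :
    LinearMap.det ((Matrix.toLin' M).restrictScalars ℝ) = ‖M.det‖ ^ 2 := by
  rw [LinearMap.det_restrictScalars, Algebra.norm_complex_apply, LinearMap.det_toLin',
    Complex.normSq_eq_norm_sq]

/-! ### Change of variables to the roots -/

/-- The polynomial `X^N + ∑ b_k X^k`. -/
noncomputable def monicOfCoeffs {N : ℕ} (b : Fin N → ℂ) : ℂ[X] :=
  X ^ N + ∑ k : Fin N, C (b k) * X ^ (k : ℕ)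

theorem degree_sum_C_mul_X_pow_lt {N : ℕ} (b : Fin N → ℂ) :
    (∑ k : Fin N, C (b k) * X ^ (k : ℕ)).degree < (N : WithBot ℕ) := by
  refine (degree_sum_le _ _).trans_lt ((Finset.sup_lt_iff (WithBot.bot_lt_coe N)).2 fun k _ => ?_)
  exact (degree_C_mul_X_pow_le _ _).trans_lt (WithBot.coe_lt_coe.2 k.2)

theorem monic_monicOfCoeffs {N : ℕ} (b : Fin N → ℂ) : (monicOfCoeffs b).Monic :=
  monic_X_pow_add (degree_sum_C_mul_X_pow_lt b)

theorem natDegree_monicOfCoeffs {N : ℕ} (b : Fin N → ℂ) : (monicOfCoeffs b).natDegree = N := by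
  refine natDegree_eq_of_degree_eq_some ?_
  rw [monicOfCoeffs, degree_add_eq_left_of_degree_lt, degree_X_pow]
  simpa using degree_sum_C_mul_X_pow_lt b

theorem coeff_monicOfCoeffs {N : ℕ} (b : Fin N → ℂ) (k : Fin N) :
    (monicOfCoeffs b).coeff k = b k := by
  simp only [monicOfCoeffs, coeff_add, coeff_X_pow, k.2.ne, finsetSum_coeff, coeff_C_mul,
    Fin.val_inj]
  simp

theorem monicOfCoeffs_coeffsOfRoots {N : ℕ} (β : Fin N → ℂ) :
    monicOfCoeffs (coeffsOfRoots β) = ∏ i, (X - C (β i)) := by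
  have hm : (∏ i, (X - C (β i))).Monic := monic_prod_of_monic _ _ fun i _ => monic_X_sub_C _
  have hd : (∏ i, (X - C (β i))).natDegree = N := by
    rw [natDegree_prod_of_monic _ _ fun j _ => monic_X_sub_C _]; simp
  conv_rhs => rw [hm.as_sum, hd]
  rw [monicOfCoeffs, Finset.sum_range]
  rfl

/-- The fundamental theorem of algebra: every coefficient vector comes from a root vector. -/
theorem exists_coeffsOfRoots_eq {N : ℕ} (b : Fin N → ℂ) : ∃ β, coeffsOfRoots β = b := by
  have hs := IsAlgClosed.splits (monicOfCoeffs b)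
  have hp := hs.eq_prod_roots_of_monic (monic_monicOfCoeffs b)
  have hc := hs.natDegree_eq_card_roots
  rw [natDegree_monicOfCoeffs] at hc
  obtain ⟨l, hl⟩ := Quot.exists_rep (monicOfCoeffs b).roots
  change (l : Multiset ℂ) = _ at hl
  rw [← hl] at hp hc
  rw [Multiset.coe_card] at hc
  subst hc
  refine ⟨fun i => l.get i, funext fun k => ?_⟩
  rw [← coeff_monicOfCoeffs b k, hp, coeffsOfRoots]
  congr 1
  simp [← Fin.prod_univ_fun_getElem]

/-- The set of root vectors whose real parts increase strictly along the ordering `σ`. -/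
def sortedRoots {N : ℕ} (σ : Equiv.Perm (Fin N)) : Set (Fin N → ℂ) :=
  {β | StrictMono fun i => (β (σ i)).re}

theorem measurableSet_sortedRoots {N : ℕ} (σ : Equiv.Perm (Fin N)) :
    MeasurableSet (sortedRoots σ) := by
  have : sortedRoots σ = ⋂ i, ⋂ j, ⋂ _ : i < j,
      {β : Fin N → ℂ | (β (σ i)).re < (β (σ j)).re} := by
    ext β; simp [sortedRoots, StrictMono]
  rw [this]
  refine .iInter fun i => .iInter fun j => .iInter fun _ => measurableSet_lt ?_ ?_ <;> fun_prop

theorem injective_of_mem_sortedRoots {N : ℕ} {σ : Equiv.Perm (Fin N)} {β : Fin N → ℂ}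
    (h : β ∈ sortedRoots σ) : Function.Injective β := by
  have := h.injective
  intro i j hij
  have h2 := @this (σ.symm i) (σ.symm j) (by simp [hij])
  simpa using h2

theorem range_eq_of_coeffsOfRoots_eq {N : ℕ} {β γ : Fin N → ℂ}
    (h : coeffsOfRoots β = coeffsOfRoots γ) : Set.range β = Set.range γ := by
  have hp : ∏ i, (X - C (β i)) = ∏ i, (X - C (γ i)) := by
    rw [← monicOfCoeffs_coeffsOfRoots, h, monicOfCoeffs_coeffsOfRoots]
  ext z
  have := congrArg (fun p => p.eval z = 0) hp
  simp only [eval_prod, eval_sub, eval_X, eval_C, Finset.prod_eq_zero_iff, sub_eq_zero,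
    Finset.mem_univ, true_and] at this
  simpa only [Set.mem_range, eq_comm, eq_iff_iff] using this

/-- The coefficients determine the set of roots, and the ordering by real parts determines which
root carries which index. -/
theorem injOn_coeffsOfRoots {N : ℕ} (σ : Equiv.Perm (Fin N)) :
    Set.InjOn coeffsOfRoots (sortedRoots σ) := by
  intro β hβ γ hγ h
  have hr := range_eq_of_coeffsOfRoots_eq h
  have hre : (fun i => (β (σ i)).re) = fun i => (γ (σ i)).re := by
    refine (StrictMono.range_inj hβ hγ).1 ?_
    change Set.range ((Complex.re ∘ β) ∘ σ) = Set.range ((Complex.re ∘ γ) ∘ σ)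
    rw [σ.surjective.range_comp, σ.surjective.range_comp, Set.range_comp, Set.range_comp, hr]
  funext i
  obtain ⟨j, hj⟩ : β i ∈ Set.range γ := hr ▸ Set.mem_range_self i
  have h1 := congrFun hre (σ.symm i)
  have h2 : σ.symm j = σ.symm i := hγ.injective (by simpa [hj] using h1)
  rw [← hj, σ.symm.injective h2]

theorem differentiable_coeffsOfRoots (N : ℕ) :
    Differentiable ℝ (coeffsOfRoots : (Fin N → ℂ) → Fin N → ℂ) :=
  fun β => ((hasFDerivAt_coeffsOfRoots β).restrictScalars ℝ).differentiableAt

theorem iUnion_sortedRoots (N : ℕ) :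
    ⋃ σ, sortedRoots σ = {β : Fin N → ℂ | Function.Injective fun i => (β i).re} := by
  ext β
  simp only [Set.mem_iUnion, Set.mem_ofPred_eq, sortedRoots]
  constructor
  · rintro ⟨σ, h⟩ i j hij
    have h2 := h.injective (a₁ := σ.symm i) (a₂ := σ.symm j) (by simpa using hij)
    simpa using h2
  · intro h
    exact ⟨Tuple.sort fun i => (β i).re, (Tuple.monotone_sort _).strictMono_of_injective
      (h.comp (Equiv.injective _))⟩

/-- The root vectors outside all the sets `sortedRoots σ` lie in the real hyperplanes
`re βᵢ = re βⱼ`. -/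
theorem volume_compl_iUnion_sortedRoots (N : ℕ) :
    volume (⋃ σ, sortedRoots σ : Set (Fin N → ℂ))ᶜ = 0 := by
  have : (⋃ σ, sortedRoots σ : Set (Fin N → ℂ))ᶜ ⊆ ⋃ i, ⋃ j, ⋃ _ : i ≠ j,
      ((LinearMap.ker (Complex.reLm ∘ₗ (LinearMap.proj (R := ℝ) (φ := fun _ : Fin N => ℂ) i -
        LinearMap.proj (R := ℝ) (φ := fun _ : Fin N => ℂ) j)) : Submodule ℝ (Fin N → ℂ)) :
          Set (Fin N → ℂ)) := by
    intro β hβ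
    rw [iUnion_sortedRoots] at hβ
    simp only [Set.mem_compl_iff, Set.mem_ofPred_eq, Function.Injective, not_forall] at hβ
    obtain ⟨i, j, h, hij⟩ := hβ
    simp only [Set.mem_iUnion]
    exact ⟨i, j, hij, by simp [h]⟩
  refine measure_mono_null this ?_
  simp only [measure_iUnion_null_iff]
  intro i j hij
  refine Measure.addHaar_submodule _ _ fun htop => ?_
  rw [LinearMap.ker_eq_top] at htop
  have := LinearMap.congr_fun htop (Pi.single i 1)
  simp [hij.symm] at this

theorem pairwise_disjoint_sortedRoots (N : ℕ) :
    Pairwise (Function.onFun Disjoint (sortedRoots : Equiv.Perm (Fin N) → Set (Fin N → ℂ))) := by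
  intro σ τ hστ
  refine Set.disjoint_left.2 fun β hσ hτ => hστ ?_
  have hi : Function.Injective fun i => (β i).re := by
    have : β ∈ ⋃ σ, sortedRoots σ := Set.mem_iUnion.2 ⟨σ, hσ⟩
    rwa [iUnion_sortedRoots] at this
  have := Tuple.unique_monotone (f := fun i => (β i).re) hσ.monotone hτ.monotone
  ext i
  exact congrArg Fin.val (hi (congrFun this i))

/-- Up to a relabelling of the roots, a single `sortedRoots σ` already reaches every polynomial
whose roots have distinct real parts. -/
theorem compl_image_sortedRoots_subset {N : ℕ} (σ : Equiv.Perm (Fin N)) :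
    (coeffsOfRoots '' sortedRoots σ)ᶜ ⊆
      coeffsOfRoots '' (⋃ σ, sortedRoots σ : Set (Fin N → ℂ))ᶜ := by
  intro b hb
  obtain ⟨β, rfl⟩ := exists_coeffsOfRoots_eq b
  refine ⟨β, fun hβ => hb ?_, rfl⟩
  obtain ⟨τ, hτ⟩ := Set.mem_iUnion.1 hβ
  refine ⟨fun i => β (τ (σ.symm i)), by simpa [sortedRoots] using hτ, funext fun k => ?_⟩
  simp only [coeffsOfRoots]
  congr 1
  exact Fintype.prod_equiv (σ.symm.trans τ) _ _ fun i => rfl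

theorem restrict_eq_self_of_null_compl {α : Type*} [MeasurableSpace α] {μ : Measure α} {s : Set α}
    (h : μ sᶜ = 0) : μ.restrict s = μ :=
  Measure.restrict_eq_self_of_ae_mem (mem_ae_iff.2 h)

/-- Change of variables from the coefficients of a monic polynomial to its roots: the map is
`N!`-to-one away from a null set. -/
theorem factorial_mul_lintegral_eq_lintegral_roots {N : ℕ} (g : (Fin N → ℂ) → ENNReal) :
    (N.factorial : ENNReal) * ∫⁻ b, g b =
      ∫⁻ β, ENNReal.ofReal (‖(Matrix.vandermonde β).det‖ ^ 2) * g (coeffsOfRoots β) := by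
  have hσ : ∀ σ : Equiv.Perm (Fin N), ∫⁻ β in sortedRoots σ,
      ENNReal.ofReal (‖(Matrix.vandermonde β).det‖ ^ 2) * g (coeffsOfRoots β) = ∫⁻ b, g b := by
    intro σ
    -- The missed polynomials are the image of a null set under a differentiable map.
    have hnull : volume (coeffsOfRoots '' sortedRoots σ)ᶜ = 0 :=
      measure_mono_null (compl_image_sortedRoots_subset σ)
        (addHaar_image_eq_zero_of_differentiableOn_of_addHaar_eq_zero volume
          (differentiable_coeffsOfRoots N).differentiableOn (volume_compl_iUnion_sortedRoots N))
    have h := lintegral_image_eq_lintegral_abs_det_fderiv_mul volume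
      (measurableSet_sortedRoots σ)
      (fun β _ => ((hasFDerivAt_coeffsOfRoots β).restrictScalars ℝ).hasFDerivWithinAt)
      (injOn_coeffsOfRoots σ) g
    rw [restrict_eq_self_of_null_compl hnull] at h
    rw [h]
    refine setLIntegral_congr_fun (measurableSet_sortedRoots σ) fun β hβ => ?_
    have hdet : ((LinearMap.toContinuousLinearMap (Matrix.toLin'
        (jacobianCoeffsOfRoots β))).restrictScalars ℝ).det =
        ‖(jacobianCoeffsOfRoots β).det‖ ^ 2 := det_restrictScalars_toLin' _
    simp only [hdet, norm_det_jacobianCoeffsOfRoots (injective_of_mem_sortedRoots hβ), abs_pow,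
      abs_norm]
  have hU := lintegral_iUnion (μ := volume) measurableSet_sortedRoots
    (pairwise_disjoint_sortedRoots N)
    fun β => ENNReal.ofReal (‖(Matrix.vandermonde β).det‖ ^ 2) * g (coeffsOfRoots β)
  rw [restrict_eq_self_of_null_compl (volume_compl_iUnion_sortedRoots N)] at hU
  rw [hU]
  simp only [hσ, tsum_fintype, Finset.sum_const, Finset.card_univ, Fintype.card_perm,
    Fintype.card_fin, nsmul_eq_mul]

/-! ### Mahler measure in terms of the roots -/

/-- The polynomial `x^N q(x + x⁻¹)` attached to a polynomial `q` of degree at most `N`;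
coefficients of `q` beyond degree `N` are ignored. -/
noncomputable def joukowskiLift (N : ℕ) (q : ℂ[X]) : ℂ[X] :=
  ∑ k ∈ Finset.range (N + 1), C (q.coeff k) * X ^ (N - k) * (X ^ 2 + 1) ^ k

theorem eval_joukowskiLift {N : ℕ} {q : ℂ[X]} (hq : q.natDegree ≤ N) {x : ℂ} (hx : x ≠ 0) :
    (joukowskiLift N q).eval x = x ^ N * q.eval (x + x⁻¹) := by
  rw [eval_eq_sum_range' (Nat.lt_succ_of_le hq), joukowskiLift, eval_finsetSum, Finset.mul_sum]
  refine Finset.sum_congr rfl fun k hk => ?_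
  have hk' : k ≤ N := Nat.lt_succ_iff.1 (Finset.mem_range.1 hk)
  have h1 : x ^ 2 + 1 = x * (x + x⁻¹) := by field_simp
  have h2 : x ^ N = x ^ (N - k) * x ^ k := by rw [← pow_add, Nat.sub_add_cancel hk']
  simp only [eval_mul, eval_C, eval_pow, eval_X, eval_add, eval_one]
  rw [h1, h2, mul_pow]
  ring

theorem eq_of_eval_eq_of_ne_zero {p q : ℂ[X]} (h : ∀ x ≠ 0, p.eval x = q.eval x) : p = q :=
  eq_of_infinite_eval_eq p q <| (Set.finite_singleton (0 : ℂ)).infinite_compl.mono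
    fun x hx => h x hx

theorem joukowskiLift_C_mul (N : ℕ) (a : ℂ) (q : ℂ[X]) :
    joukowskiLift N (C a * q) = C a * joukowskiLift N q := by
  simp only [joukowskiLift, Finset.mul_sum, coeff_C_mul, C_mul, mul_assoc]

/-- The contribution of a root `β` of `q` to the Mahler measure of `q(x + x⁻¹)`, that is, the
Mahler measure of `X² - βX + 1 = (X - γ)(X - γ⁻¹)` for `β = γ + γ⁻¹`. It equals
the larger of `|γ|` and `|γ⁻¹|`. -/
noncomputable def rootHeight (β : ℂ) : ℝ := (X ^ 2 - C β * X + 1 : ℂ[X]).mahlerMeasure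

theorem rootHeight_pos (β : ℂ) : 0 < rootHeight β := by
  refine mahlerMeasure_pos_of_ne_zero fun h => ?_
  have := congrArg (fun p => p.eval 0) h
  simp at this

theorem rootHeight_add_inv {γ : ℂ} (hγ : 1 < ‖γ‖) : rootHeight (γ + γ⁻¹) = ‖γ‖ := by
  have h0 : γ ≠ 0 := by rintro rfl; simp at hγ; linarith
  have : (X ^ 2 - C (γ + γ⁻¹) * X + 1 : ℂ[X]) = (X - C γ) * (X - C γ⁻¹) := by
    have h1 : (1 : ℂ[X]) = C γ * C γ⁻¹ := by rw [← C_mul, mul_inv_cancel₀ h0, C_1]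
    rw [h1, C_add]; ring
  rw [rootHeight, this, mahlerMeasure_mul, mahlerMeasure_X_sub_C, mahlerMeasure_X_sub_C, norm_inv,
    max_eq_right hγ.le, max_eq_left (inv_le_one_of_one_le₀ hγ.le), mul_one]

theorem joukowskiLift_prod {N : ℕ} (β : Fin N → ℂ) :
    joukowskiLift N (∏ i, (X - C (β i))) = ∏ i, (X ^ 2 - C (β i) * X + 1) := by
  refine eq_of_eval_eq_of_ne_zero fun x hx => ?_
  rw [eval_joukowskiLift _ hx, eval_prod, eval_prod]
  · have : x ^ N = ∏ _i : Fin N, x := by simp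
    rw [this, ← Finset.prod_mul_distrib]
    refine Finset.prod_congr rfl fun i _ => ?_
    simp only [eval_sub, eval_X, eval_C, eval_add, eval_pow, eval_mul, eval_one]
    field_simp
    ring
  · rw [natDegree_prod_of_monic _ _ fun j _ => monic_X_sub_C _]; simp

theorem mahlerMeasure_prod {ι : Type*} (s : Finset ι) (f : ι → ℂ[X]) :
    (∏ i ∈ s, f i).mahlerMeasure = ∏ i ∈ s, (f i).mahlerMeasure := by
  classical
  induction s using Finset.induction_on with
  | empty => simp
  | insert a s ha ih => rw [Finset.prod_insert ha, Finset.prod_insert ha, mahlerMeasure_mul, ih]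

/-- The reciprocal Mahler measure of `q(x + x⁻¹)` for `q = X^N + ∑ b_k X^k`. -/
noncomputable def monicHeight {N : ℕ} (b : Fin N → ℂ) : ℝ :=
  (joukowskiLift N (monicOfCoeffs b)).mahlerMeasure

theorem monicHeight_coeffsOfRoots {N : ℕ} (β : Fin N → ℂ) :
    monicHeight (coeffsOfRoots β) = ∏ i, rootHeight (β i) := by
  rw [monicHeight, monicOfCoeffs_coeffsOfRoots, joukowskiLift_prod, mahlerMeasure_prod]
  rfl

theorem monicHeight_pos {N : ℕ} (b : Fin N → ℂ) : 0 < monicHeight b := by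
  obtain ⟨β, rfl⟩ := exists_coeffsOfRoots_eq b
  rw [monicHeight_coeffsOfRoots]
  exact Finset.prod_pos fun i _ => rootHeight_pos _

/-! ### Reciprocal polynomials -/

/-- The reciprocal polynomial `x^N p_v(x)`. -/
noncomputable def recPoly {N : ℕ} (v : Fin (N + 1) → ℂ) : ℂ[X] :=
  C (v 0) * X ^ N + ∑ n : Fin N, C (v n.succ) * (X ^ (N + (n + 1)) + X ^ (N - (n + 1)))

theorem eval_recPoly {N : ℕ} (v : Fin (N + 1) → ℂ) {x : ℂ} (hx : x ≠ 0) :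
    (recPoly v).eval x = x ^ N * recLaurent v x := by
  simp only [recPoly, recLaurent, eval_add, eval_mul, eval_C, eval_pow, eval_X, eval_finsetSum,
    mul_add, Finset.mul_sum]
  congr 1
  · ring
  · refine Finset.sum_congr rfl fun n _ => ?_
    have h2 : x ^ N = x ^ (N - (n + 1)) * x ^ ((n : ℕ) + 1) := by
      rw [← pow_add, Nat.sub_add_cancel n.2]
    have h3 : x ^ ((n : ℕ) + 1) * x⁻¹ ^ ((n : ℕ) + 1) = 1 := by
      rw [← mul_pow, mul_inv_cancel₀ hx, one_pow]
    rw [pow_add]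
    congr 1
    · ring
    · rw [h2]; linear_combination -(x ^ (N - ((n : ℕ) + 1)) * v n.succ) * h3

theorem coeff_recPoly_sub {N : ℕ} (v : Fin (N + 1) → ℂ) (n : Fin (N + 1)) :
    (recPoly v).coeff (N - n) = v n := by
  have hn := n.2
  refine Fin.cases ?_ (fun n => ?_) n
  · simp only [recPoly, coeff_add, finsetSum_coeff, coeff_C_mul, coeff_X_pow]
    rw [Finset.sum_eq_zero]
    · simp
    · intro m _
      rw [if_neg (by simp), if_neg (by simp; omega)]; simp
  · simp only [recPoly, coeff_add, finsetSum_coeff, coeff_C_mul, coeff_X_pow]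
    rw [Finset.sum_eq_single n]
    · rw [if_neg (by simp; omega), if_neg (by simp; omega), if_pos (by simp)]; simp
    · intro m _ hm
      have : (m : ℕ) ≠ n := fun h => hm (Fin.ext h)
      rw [if_neg (by simp; omega), if_neg (by simp; omega)]; simp
    · simp

theorem coeff_recPoly_add {N : ℕ} (v : Fin (N + 1) → ℂ) (n : Fin (N + 1)) :
    (recPoly v).coeff (N + n) = v n := by
  refine Fin.cases ?_ (fun n => ?_) n
  · simp only [recPoly, coeff_add, finsetSum_coeff, coeff_C_mul, coeff_X_pow]
    rw [Finset.sum_eq_zero]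
    · simp
    · intro m _
      rw [if_neg (by simp), if_neg (by simp; omega)]; simp
  · simp only [recPoly, coeff_add, finsetSum_coeff, coeff_C_mul, coeff_X_pow]
    rw [Finset.sum_eq_single n]
    · rw [if_neg (by simp), if_pos (by simp), if_neg (by simp; omega)]; simp
    · intro m _ hm
      have : (m : ℕ) ≠ n := fun h => hm (Fin.ext h)
      rw [if_neg (by simp; omega), if_neg (by simp; omega)]; simp
    · simp

theorem natDegree_recPoly_le {N : ℕ} (v : Fin (N + 1) → ℂ) : (recPoly v).natDegree ≤ 2 * N := by
  rw [natDegree_le_iff_coeff_eq_zero]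
  intro m hm
  simp only [recPoly, coeff_add, finsetSum_coeff, coeff_C_mul, coeff_X_pow]
  rw [Finset.sum_eq_zero, if_neg (by omega)]
  · simp
  · intro n _
    rw [if_neg (by omega), if_neg (by omega)]; simp

theorem recPoly_mem_reciprocalPolynomials {N : ℕ} (v : Fin (N + 1) → ℂ) :
    recPoly v ∈ reciprocalPolynomials N := by
  refine ⟨natDegree_recPoly_le v, fun m hm => ?_⟩
  rcases le_total m N with h | h
  · have h1 := coeff_recPoly_sub v ⟨N - m, by omega⟩
    have h2 := coeff_recPoly_add v ⟨N - m, by omega⟩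
    simp only [Nat.sub_sub_self h] at h1
    rw [h1, ← h2]; congr 1; simp only; omega
  · have h1 := coeff_recPoly_sub v ⟨m - N, by omega⟩
    have h2 := coeff_recPoly_add v ⟨m - N, by omega⟩
    simp only [Nat.add_sub_cancel' h] at h2
    rw [h2, ← h1]; congr 1; simp only; omega

theorem reciprocalCoords_recPoly {N : ℕ} (v : Fin (N + 1) → ℂ) :
    reciprocalCoords N (recPoly v) = v :=
  funext fun n => coeff_recPoly_add v n

/-- A reciprocal polynomial is determined by its coefficients of index at least `N`. -/
theorem recPoly_reciprocalCoords {N : ℕ} {f : ℂ[X]} (hf : f ∈ reciprocalPolynomials N) :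
    recPoly (reciprocalCoords N f) = f := by
  have hr := recPoly_mem_reciprocalPolynomials (reciprocalCoords N f)
  have key : ∀ m, N ≤ m → (recPoly (reciprocalCoords N f)).coeff m = f.coeff m := by
    intro m hm
    rcases le_or_gt m (2 * N) with h | h
    · have := coeff_recPoly_add (reciprocalCoords N f) ⟨m - N, by omega⟩
      simpa [reciprocalCoords, Nat.add_sub_cancel' hm] using this
    · rw [coeff_eq_zero_of_natDegree_lt (hr.1.trans_lt h),
        coeff_eq_zero_of_natDegree_lt (hf.1.trans_lt h)]
  ext m
  rcases le_total N m with h | h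
  · exact key m h
  · rw [hr.2 m (by omega), hf.2 m (by omega), key _ (by omega)]

theorem recPoly_eq_zero_iff {N : ℕ} {v : Fin (N + 1) → ℂ} : recPoly v = 0 ↔ v = 0 := by
  constructor
  · intro h
    rw [← reciprocalCoords_recPoly v, h]
    ext n; simp [reciprocalCoords]
  · rintro rfl; simp [recPoly]

/-- The factor `x^N` has modulus one on the unit circle, so it does not affect the Mahler
measure. -/
theorem mahlerMeasure_recPoly {N : ℕ} (v : Fin (N + 1) → ℂ) :
    (recPoly v).mahlerMeasure = recMahlerMeasure v := by
  by_cases hv : v = 0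
  · simp [recMahlerMeasure, hv, recPoly_eq_zero_iff.2]
  · rw [mahlerMeasure_def_of_ne_zero (recPoly_eq_zero_iff.not.2 hv), recMahlerMeasure, if_neg hv]
    congr 1
    have h := intervalIntegral.integral_comp_mul_left (a := 0) (b := 1)
      (fun t => Real.log ‖(recPoly v).eval (circleMap 0 1 t)‖) (c := 2 * Real.pi) (by positivity)
    rw [mul_zero, mul_one, smul_eq_mul] at h
    rw [← h]
    refine intervalIntegral.integral_congr fun t _ => ?_
    have he : circleMap 0 1 (2 * Real.pi * t) = Complex.exp (2 * Real.pi * Complex.I * t) := by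
      simp only [circleMap, zero_add, Complex.ofReal_one, one_mul]
      push_cast; ring_nf
    have hn : ‖circleMap 0 1 (2 * Real.pi * t)‖ = 1 := by simp
    rw [eval_recPoly v (by rw [← norm_ne_zero_iff, hn]; exact one_ne_zero), norm_mul, norm_pow, hn,
      one_pow, one_mul, he]

theorem image_reciprocalCoords_eq (N : ℕ) :
    reciprocalCoords N '' {f ∈ reciprocalPolynomials N | f.mahlerMeasure ≤ 1} = recStarBody N := by
  ext v
  constructor
  · rintro ⟨f, ⟨hf, hm⟩, rfl⟩
    change recMahlerMeasure _ ≤ 1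
    rwa [← mahlerMeasure_recPoly, recPoly_reciprocalCoords hf]
  · intro hv
    exact ⟨recPoly v, ⟨recPoly_mem_reciprocalPolynomials v, (mahlerMeasure_recPoly v).trans_le hv⟩,
      reciprocalCoords_recPoly v⟩

theorem measurable_recMahlerMeasure (N : ℕ) :
    Measurable (recMahlerMeasure : (Fin (N + 1) → ℂ) → ℝ) := by
  classical
  have hI : Measurable fun v : Fin (N + 1) → ℂ => ∫ t in (0 : ℝ)..1,
      Real.log ‖recLaurent v (Complex.exp (2 * Real.pi * Complex.I * t))‖ := by
    simp only [intervalIntegral.integral_of_le zero_le_one]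
    refine StronglyMeasurable.measurable (StronglyMeasurable.integral_prod_right
      (f := fun (v : Fin (N + 1) → ℂ) (t : ℝ) =>
        Real.log ‖recLaurent v (Complex.exp (2 * Real.pi * Complex.I * t))‖) ?_)
    refine Measurable.stronglyMeasurable ?_
    unfold Function.uncurry recLaurent
    fun_prop
  have : (recMahlerMeasure : (Fin (N + 1) → ℂ) → ℝ) = fun v => if v = 0 then 0 else
      Real.exp (∫ t in (0 : ℝ)..1,
        Real.log ‖recLaurent v (Complex.exp (2 * Real.pi * Complex.I * t))‖) := by
    funext v; simp only [recMahlerMeasure]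
  rw [this]
  exact Measurable.ite (measurableSet_singleton 0) measurable_const (Real.measurable_exp.comp hI)

/-! ### Andréief's identity -/

/-- Andréief's identity for an orthogonal family: only the diagonal terms of the expanded
product of determinants survive. -/
theorem lintegral_norm_det_sq {N : ℕ} {μ : Measure ℂ} [SigmaFinite μ] (f : Fin N → ℂ → ℂ)
    (c : Fin N → ℝ)
    (hint : ∀ j k, Integrable (fun z => f j z * conj (f k z)) μ)
    (horth : ∀ j k, ∫ z, f j z * conj (f k z) ∂μ = if j = k then (c j : ℂ) else 0) :
    ∫⁻ β, ENNReal.ofReal (‖(Matrix.of fun i k => f k (β i)).det‖ ^ 2) ∂(Measure.pi fun _ => μ) =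
      ENNReal.ofReal (N.factorial * ∏ j, c j) := by
  have hexp : ∀ β : Fin N → ℂ, ((‖(Matrix.of fun i k => f k (β i)).det‖ ^ 2 : ℝ) : ℂ) =
      ∑ σ : Equiv.Perm (Fin N), ∑ τ : Equiv.Perm (Fin N),
        ((Equiv.Perm.sign σ : ℤ) : ℂ) * ((Equiv.Perm.sign τ : ℤ) : ℂ) *
          ∏ i, (f (σ i) (β i) * conj (f (τ i) (β i))) := by
    intro β
    push_cast
    rw [← Complex.mul_conj', ← Matrix.det_transpose, Matrix.det_apply', map_sum,
      Finset.sum_mul_sum]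
    refine Finset.sum_congr rfl fun σ _ => Finset.sum_congr rfl fun τ _ => ?_
    rw [map_mul, map_prod, Finset.prod_mul_distrib]
    simp only [Matrix.transpose_apply, Matrix.of_apply, map_intCast]
    ring
  have hI : ∀ σ τ : Equiv.Perm (Fin N), Integrable (fun β : Fin N → ℂ =>
      ((Equiv.Perm.sign σ : ℤ) : ℂ) * ((Equiv.Perm.sign τ : ℤ) : ℂ) *
          ∏ i, (f (σ i) (β i) * conj (f (τ i) (β i)))) (Measure.pi fun _ => μ) := fun σ τ =>
    (Integrable.fintype_prod (f := fun i z => f (σ i) z * conj (f (τ i) z))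
      fun i => hint (σ i) (τ i)).const_mul _
  have hIC : Integrable (fun β : Fin N → ℂ =>
      ((‖(Matrix.of fun i k => f k (β i)).det‖ ^ 2 : ℝ) : ℂ)) (Measure.pi fun _ => μ) := by
    simp only [hexp]
    exact integrable_finsetSum _ fun σ _ => integrable_finsetSum _ fun τ _ => hI σ τ
  have hIR : Integrable (fun β : Fin N → ℂ =>
      ‖(Matrix.of fun i k => f k (β i)).det‖ ^ 2) (Measure.pi fun _ => μ) := by
    simpa only [RCLike.re_to_complex, Complex.ofReal_re] using hIC.re
  rw [← ofReal_integral_eq_lintegral_ofReal hIR (ae_of_all _ fun β => by positivity)]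
  congr 1
  rw [← Complex.ofReal_inj, ← integral_complex_ofReal]
  simp only [hexp]
  rw [integral_finsetSum _ fun σ _ => integrable_finsetSum _ fun τ _ => hI σ τ]
  have hσ : ∀ σ : Equiv.Perm (Fin N), ∫ β : Fin N → ℂ, ∑ τ : Equiv.Perm (Fin N),
        ((Equiv.Perm.sign σ : ℤ) : ℂ) * ((Equiv.Perm.sign τ : ℤ) : ℂ) *
          ∏ i, (f (σ i) (β i) * conj (f (τ i) (β i))) ∂(Measure.pi fun _ => μ) =
      ∏ j, (c j : ℂ) := by
    intro σ
    rw [integral_finsetSum _ fun τ _ => hI σ τ]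
    have hστ : ∀ τ : Equiv.Perm (Fin N), ∫ β : Fin N → ℂ,
        ((Equiv.Perm.sign σ : ℤ) : ℂ) * ((Equiv.Perm.sign τ : ℤ) : ℂ) *
          ∏ i, (f (σ i) (β i) * conj (f (τ i) (β i))) ∂(Measure.pi fun _ => μ) =
        ((Equiv.Perm.sign σ : ℤ) : ℂ) * ((Equiv.Perm.sign τ : ℤ) : ℂ) *
          ∏ i, if σ i = τ i then (c (σ i) : ℂ) else 0 := fun τ => by
      rw [integral_const_mul,
        integral_fintype_prod_eq_prod (f := fun i z => f (σ i) z * conj (f (τ i) z))]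
      simp only [horth]
    simp only [hστ]
    rw [Finset.sum_eq_single σ]
    · rw [← Int.cast_mul, ← Units.val_mul, Int.units_mul_self]
      simp only [if_true, Units.val_one, Int.cast_one, one_mul]
      exact Equiv.prod_comp σ fun j => (c j : ℂ)
    · intro τ _ hτ
      obtain ⟨i, hi⟩ : ∃ i, σ i ≠ τ i := by
        by_contra! h
        exact hτ (Equiv.ext fun i => (h i).symm)
      rw [Finset.prod_eq_zero (Finset.mem_univ i) (if_neg hi), mul_zero]
    · simp
  simp only [hσ, Finset.sum_const, Finset.card_univ, Fintype.card_perm, Fintype.card_fin,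
    nsmul_eq_mul]
  push_cast
  rfl

/-! ### Chebyshev polynomials -/

theorem monic_X_mul_sub {p q : ℂ[X]} {n : ℕ} (hp : p.Monic ∧ p.natDegree = n)
    (hq : q.Monic ∧ q.natDegree = n + 1) :
    (X * q - p).Monic ∧ (X * q - p).natDegree = n + 2 := by
  have hXq : (X * q).natDegree = n + 2 := by
    rw [monic_X.natDegree_mul hq.1, hq.2, natDegree_X]; ring
  have hlt : p.natDegree < (X * q).natDegree := by omega
  refine ⟨(monic_X.mul hq.1).sub_of_left (degree_lt_degree hlt), ?_⟩
  rw [natDegree_sub_eq_left_of_natDegree_lt hlt, hXq]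

theorem monic_chebyshev_S (n : ℕ) :
    (Chebyshev.S ℂ n).Monic ∧ (Chebyshev.S ℂ n).natDegree = n := by
  induction n using Nat.twoStepInduction with
  | zero => simp
  | one => simp [monic_X]
  | more n h0 h1 =>
    have := monic_X_mul_sub h0 h1
    push_cast at this ⊢
    rwa [← Chebyshev.S_add_two] at this

theorem monic_chebyshev_C (n : ℕ) :
    (Chebyshev.C ℂ (n + 1)).Monic ∧ (Chebyshev.C ℂ (n + 1)).natDegree = n + 1 := by
  induction n using Nat.twoStepInduction with
  | zero => simp [monic_X]
  | one =>
    have h : Chebyshev.C ℂ ((1 : ℕ) + 1) = X ^ 2 - C 2 := by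
      rw [Nat.cast_one, one_add_one_eq_two, Chebyshev.C_two]; rfl
    rw [h]
    exact ⟨monic_X_pow_sub_C _ (by norm_num), natDegree_X_pow_sub_C⟩
  | more n h0 h1 =>
    have := monic_X_mul_sub h0 h1
    push_cast at this ⊢
    rw [show (n : ℤ) + 2 + 1 = (n + 1) + 2 by ring, Chebyshev.C_add_two]
    exact ⟨this.1, by rw [this.2]⟩

theorem eval_chebyshev_C {x : ℂ} (hx : x ≠ 0) (n : ℕ) :
    (Chebyshev.C ℂ n).eval (x + x⁻¹) = x ^ n + x⁻¹ ^ n := by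
  induction n using Nat.twoStepInduction with
  | zero => norm_num
  | one => simp
  | more n h0 h1 =>
    push_cast at h0 h1 ⊢
    rw [Chebyshev.C_add_two, eval_sub, eval_mul, h0, h1, eval_X]
    linear_combination (x ^ n + x⁻¹ ^ n) * mul_inv_cancel₀ hx

theorem eval_chebyshev_S {x : ℂ} (hx : x ≠ 0) (n : ℕ) :
    (x - x⁻¹) * (Chebyshev.S ℂ n).eval (x + x⁻¹) = x ^ (n + 1) - x⁻¹ ^ (n + 1) := by
  induction n using Nat.twoStepInduction with
  | zero => simp
  | one => simp; ring
  | more n h0 h1 =>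
    push_cast at h0 h1 ⊢
    rw [Chebyshev.S_add_two, eval_sub, eval_mul, eval_X, mul_sub, mul_left_comm, h0, h1]
    linear_combination (x ^ (n + 1) - x⁻¹ ^ (n + 1)) * mul_inv_cancel₀ hx

/-! ### Moments on the exterior of the unit disc -/

/-- The exterior of the closed unit disc. -/
def unitDiscExterior : Set ℂ := {γ | 1 < ‖γ‖}

theorem measurableSet_unitDiscExterior : MeasurableSet unitDiscExterior :=
  measurableSet_lt measurable_const measurable_norm

theorem ne_zero_of_mem_unitDiscExterior {γ : ℂ} (hγ : γ ∈ unitDiscExterior) : γ ≠ 0 := by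
  rintro rfl; simp [unitDiscExterior] at hγ; linarith


/-- The exponents are those arising from the weight `‖γ‖^(-2(N+1))` and the Jacobian of
`γ ↦ γ + γ⁻¹`; the integrand decays like `‖γ‖⁻⁴` at least. -/
theorem integrableOn_unitDiscExterior (N : ℕ) {a b : ℤ} (hab : a + b ≤ 2 * N) :
    IntegrableOn (fun γ : ℂ => (‖γ‖ : ℂ) ^ (-(2 * N + 4) : ℤ) * (γ ^ a * conj γ ^ b))
      unitDiscExterior := by
  -- The dominating function comes from `1 + ‖γ‖ ≤ 2‖γ‖` outside the disc.
  have h4 : Integrable (fun γ : ℂ => 16 * (1 + ‖γ‖) ^ (-(4 : ℝ))) :=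
    (integrable_one_add_norm (by rw [Complex.finrank_real_complex]; norm_num)).const_mul _
  refine h4.integrableOn.mono' ?_ ?_
  · refine Measurable.aestronglyMeasurable ?_
    fun_prop
  · refine (ae_restrict_iff' measurableSet_unitDiscExterior).2 (ae_of_all _ fun γ hγ => ?_)
    have h1 : 1 < ‖γ‖ := hγ
    have h0 : 0 < ‖γ‖ := by linarith
    rw [norm_mul, norm_mul, norm_zpow, norm_zpow, norm_zpow, Complex.norm_conj, Complex.norm_real,
      norm_norm, ← zpow_add₀ h0.ne', ← zpow_add₀ h0.ne']
    calc ‖γ‖ ^ (-(2 * N + 4 : ℤ) + (a + b)) ≤ ‖γ‖ ^ (-4 : ℤ) :=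
          zpow_le_zpow_right₀ h1.le (by linarith)
      _ = 16 * (2 * ‖γ‖) ^ (-(4 : ℝ)) := by
          rw [Real.rpow_neg (by positivity), zpow_neg]
          norm_cast
          rw [mul_pow]; field_simp; norm_num
      _ ≤ 16 * (1 + ‖γ‖) ^ (-(4 : ℝ)) := by
          gcongr 16 * ?_
          exact Real.rpow_le_rpow_of_nonpos (by linarith) (by linarith) (by norm_num)

theorem integral_exp_int_mul_I (m : ℤ) :
    ∫ θ in Set.Ioo (-Real.pi) Real.pi, Complex.exp (m * Complex.I * θ) =
      if m = 0 then 2 * (Real.pi : ℂ) else 0 := by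
  rw [← integral_Ioc_eq_integral_Ioo, ← intervalIntegral.integral_of_le (by linarith [Real.pi_pos])]
  split_ifs with h
  · subst h; simp; ring
  · have hm : (m : ℂ) * Complex.I ≠ 0 := by simp [h]
    rw [integral_exp_mul_complex hm, div_eq_zero_iff]
    left
    have : (m : ℂ) * Complex.I * (Real.pi : ℝ) =
        m * Complex.I * ((-Real.pi : ℝ) : ℂ) + m * (2 * Real.pi * Complex.I) := by
      push_cast; ring
    rw [this, Complex.exp_add, Complex.exp_int_mul_two_pi_mul_I, mul_one, sub_self]

theorem integral_Ioi_one_zpow {k : ℤ} (hk : k < -1) :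
    ∫ r in Set.Ioi (1 : ℝ), (r : ℂ) ^ k = -1 / (k + 1) := by
  have h := integral_Ioi_rpow_of_lt (a := (k : ℝ)) (by exact_mod_cast hk) (c := 1) one_pos
  have h2 : ∫ r in Set.Ioi (1 : ℝ), (r : ℂ) ^ k =
      ((∫ r in Set.Ioi (1 : ℝ), r ^ (k : ℝ) : ℝ) : ℂ) := by
    rw [← integral_complex_ofReal]
    refine setIntegral_congr_fun measurableSet_Ioi fun r hr => ?_
    simp [Real.rpow_intCast]
  rw [h2, h]
  simp

/-- In polar coordinates the integral splits into `∫₁^∞ r^(a+b-2N-3) dr` and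
`∫ e^(i(a-b)θ) dθ`, and the latter vanishes unless `a = b`. -/
theorem integral_unitDiscExterior (N : ℕ) {a b : ℤ} (hab : a + b ≤ 2 * N) :
    ∫ γ in unitDiscExterior, (‖γ‖ : ℂ) ^ (-(2 * N + 4) : ℤ) * (γ ^ a * conj γ ^ b) =
      if a = b then (Real.pi : ℂ) / (N + 1 - a) else 0 := by
  have hpt : ∀ p ∈ polarCoord.target, p.1 • unitDiscExterior.indicator
        (fun γ : ℂ => (‖γ‖ : ℂ) ^ (-(2 * N + 4) : ℤ) * (γ ^ a * conj γ ^ b))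
          (Complex.polarCoord.symm p) =
      (Set.Ioi (1 : ℝ) ×ˢ Set.Ioo (-Real.pi) Real.pi).indicator
        (fun p : ℝ × ℝ => (p.1 : ℂ) ^ (a + b - 2 * N - 3) *
          Complex.exp ((a - b : ℤ) * Complex.I * p.2)) p := by
    intro p hp
    rw [polarCoord_target] at hp
    have hp0 : 0 < p.1 := hp.1
    have hn : ‖Complex.polarCoord.symm p‖ = p.1 := by
      rw [Complex.norm_polarCoord_symm, abs_of_pos hp0]
    have he : Complex.polarCoord.symm p = p.1 * Complex.exp (Complex.I * p.2) := by
      rw [Complex.polarCoord_symm_apply, mul_comm Complex.I, Complex.exp_mul_I]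
      push_cast; rfl
    have hec : conj (Complex.polarCoord.symm p) = p.1 * Complex.exp (-(Complex.I * p.2)) := by
      rw [he, map_mul, Complex.conj_ofReal, ← Complex.exp_conj, map_mul, Complex.conj_I,
        Complex.conj_ofReal, neg_mul]
    have hmem : Complex.polarCoord.symm p ∈ unitDiscExterior ↔ 1 < p.1 := by
      change 1 < ‖_‖ ↔ _
      rw [hn]
    by_cases h1 : 1 < p.1
    · rw [Set.indicator_of_mem (hmem.2 h1),
        Set.indicator_of_mem
          (show p ∈ Set.Ioi (1 : ℝ) ×ˢ Set.Ioo (-Real.pi) Real.pi from ⟨h1, hp.2⟩), hn, hec, he]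
      have hpc : (p.1 : ℂ) ≠ 0 := by exact_mod_cast hp0.ne'
      rw [mul_zpow, mul_zpow, ← Complex.exp_int_mul, ← Complex.exp_int_mul, Complex.real_smul]
      have e1 : (p.1 : ℂ) ^ (a + b - 2 * N - 3) =
          p.1 * (p.1 : ℂ) ^ (-(2 * N + 4) : ℤ) * (p.1 : ℂ) ^ a * (p.1 : ℂ) ^ b := by
        rw [← zpow_one_add₀ hpc, ← zpow_add₀ hpc, ← zpow_add₀ hpc]; congr 1; ring
      have e2 : Complex.exp ((a - b : ℤ) * Complex.I * p.2) =
          Complex.exp (a * (Complex.I * p.2)) * Complex.exp (b * -(Complex.I * p.2)) := by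
        rw [← Complex.exp_add]; push_cast; ring_nf
      rw [e1, e2]; ring
    · rw [Set.indicator_of_notMem (mt hmem.1 h1),
        Set.indicator_of_notMem (fun h => h1 h.1), smul_zero]
  rw [← integral_indicator measurableSet_unitDiscExterior, ← Complex.integral_comp_polarCoord_symm,
    setIntegral_congr_fun polarCoord.open_target.measurableSet hpt,
    setIntegral_indicator (measurableSet_Ioi.prod measurableSet_Ioo)]
  have hset : polarCoord.target ∩ Set.Ioi (1 : ℝ) ×ˢ Set.Ioo (-Real.pi) Real.pi =
      Set.Ioi (1 : ℝ) ×ˢ Set.Ioo (-Real.pi) Real.pi := by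
    rw [Set.inter_eq_right, polarCoord_target]
    exact Set.prod_mono (Set.Ioi_subset_Ioi zero_le_one) subset_rfl
  rw [hset, Measure.volume_eq_prod,
    setIntegral_prod_mul (fun r : ℝ => (r : ℂ) ^ (a + b - 2 * N - 3))
    (fun θ : ℝ => Complex.exp ((a - b : ℤ) * Complex.I * θ)), integral_exp_int_mul_I,
    integral_Ioi_one_zpow (by linarith)]
  simp only [sub_eq_zero]
  split_ifs with h
  · subst h
    have hne : ((N : ℂ) + 1 - a) ≠ 0 := by
      have : ((N : ℤ) + 1 - a) ≠ 0 := by omega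
      exact_mod_cast this
    push_cast
    have hne2 : (a + a - 2 * N - 3 + 1 : ℂ) = -2 * (N + 1 - a) := by ring
    rw [hne2]
    field_simp
  · simp

/-! ### The substitution `β = γ + γ⁻¹` and orthogonality -/

/-- The equation `γ + γ⁻¹ = δ + δ⁻¹` means `(γ - δ)(γδ - 1) = 0`, and `|γδ| > 1` outside the
disc. -/
theorem injOn_add_inv : Set.InjOn (fun γ : ℂ => γ + γ⁻¹) unitDiscExterior := by
  intro γ hγ δ hδ h
  have h0 := ne_zero_of_mem_unitDiscExterior hγ
  have h1 := ne_zero_of_mem_unitDiscExterior hδ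
  have hfac : (γ - δ) * (γ * δ - 1) = 0 := by
    simp only at h
    field_simp at h
    linear_combination h
  rcases mul_eq_zero.1 hfac with h2 | h2
  · exact sub_eq_zero.1 h2
  · have : ‖γ * δ‖ = 1 := by rw [sub_eq_zero.1 h2, norm_one]
    rw [norm_mul] at this
    exact absurd this (one_lt_mul_of_lt_of_le hγ (le_of_lt hδ)).ne'

theorem exists_add_inv_eq (β : ℂ) : ∃ γ : ℂ, γ ≠ 0 ∧ γ + γ⁻¹ = β := by
  obtain ⟨γ, hγ⟩ := IsAlgClosed.exists_root (X ^ 2 - C β * X + 1 : ℂ[X]) (by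
    have : (X ^ 2 - C β * X + 1 : ℂ[X]).degree = 2 := by compute_degree!
    rw [this]; norm_num)
  have h : γ ^ 2 - β * γ + 1 = 0 := by simpa [IsRoot] using hγ
  have h0 : γ ≠ 0 := by rintro rfl; simp at h
  exact ⟨γ, h0, by field_simp; linear_combination h⟩

/-- The image of the exterior of the disc contains every non-real number: `γ + γ⁻¹` is real when
`|γ| = 1`, and `γ` may be replaced by `γ⁻¹` when `|γ| < 1`. -/
theorem volume_compl_image_add_inv :
    volume ((fun γ : ℂ => γ + γ⁻¹) '' unitDiscExterior)ᶜ = 0 := by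
  have hsub : ((fun γ : ℂ => γ + γ⁻¹) '' unitDiscExterior)ᶜ ⊆
      ((LinearMap.ker Complex.imLm : Submodule ℝ ℂ) : Set ℂ) := by
    intro β hβ
    obtain ⟨γ, h0, rfl⟩ := exists_add_inv_eq β
    rcases lt_trichotomy ‖γ‖ 1 with h | h | h
    · refine absurd ⟨γ⁻¹, ?_, ?_⟩ hβ
      · change 1 < ‖γ⁻¹‖
        rw [norm_inv]
        exact (one_lt_inv₀ (norm_pos_iff.2 h0)).2 h
      · simp [add_comm]
    · rw [Complex.inv_eq_conj h]
      simp
    · exact absurd ⟨γ, h, rfl⟩ hβ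
  refine measure_mono_null hsub (Measure.addHaar_submodule _ _ fun h => ?_)
  have := LinearMap.congr_fun (LinearMap.ker_eq_top.1 h) Complex.I
  simp at this

theorem hasFDerivAt_real_of_hasDerivAt {f : ℂ → ℂ} {f' z : ℂ} (h : HasDerivAt f f' z) :
    HasFDerivAt f ((ContinuousLinearMap.toSpanSingleton ℂ f').restrictScalars ℝ) z :=
  h.hasFDerivAt.restrictScalars ℝ

theorem det_restrictScalars_toSpanSingleton (a : ℂ) :
    ((ContinuousLinearMap.toSpanSingleton ℂ a).restrictScalars ℝ).det = ‖a‖ ^ 2 := by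
  change LinearMap.det (((ContinuousLinearMap.toSpanSingleton ℂ a : ℂ →L[ℂ] ℂ) :
    ℂ →ₗ[ℂ] ℂ).restrictScalars ℝ) = _
  rw [LinearMap.det_restrictScalars, Algebra.norm_complex_apply, LinearMap.det_ring,
    Complex.normSq_eq_norm_sq]
  simp

theorem hasDerivAt_add_inv {γ : ℂ} (h : γ ≠ 0) :
    HasDerivAt (fun γ : ℂ => γ + γ⁻¹) (1 - (γ ^ 2)⁻¹) γ := by
  have h2 := (hasDerivAt_id γ).add (hasDerivAt_inv h)
  rw [← sub_eq_add_neg] at h2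
  exact h2

theorem integrable_iff_comp_add_inv (g : ℂ → ℂ) :
    Integrable g ↔ IntegrableOn (fun γ : ℂ => ‖1 - (γ ^ 2)⁻¹‖ ^ 2 • g (γ + γ⁻¹))
      unitDiscExterior := by
  have := integrableOn_image_iff_integrableOn_abs_det_fderiv_smul volume
    measurableSet_unitDiscExterior
    (fun γ hγ => (hasFDerivAt_real_of_hasDerivAt (hasDerivAt_add_inv
      (ne_zero_of_mem_unitDiscExterior hγ))).hasFDerivWithinAt) injOn_add_inv g
  rw [IntegrableOn, restrict_eq_self_of_null_compl volume_compl_image_add_inv] at this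
  simpa only [det_restrictScalars_toSpanSingleton, abs_pow, abs_norm] using this

theorem integral_eq_integral_comp_add_inv (g : ℂ → ℂ) :
    ∫ β, g β = ∫ γ in unitDiscExterior, ‖1 - (γ ^ 2)⁻¹‖ ^ 2 • g (γ + γ⁻¹) := by
  have := integral_image_eq_integral_abs_det_fderiv_smul volume
    measurableSet_unitDiscExterior
    (fun γ hγ => (hasFDerivAt_real_of_hasDerivAt (hasDerivAt_add_inv
      (ne_zero_of_mem_unitDiscExterior hγ))).hasFDerivWithinAt) injOn_add_inv g
  rw [restrict_eq_self_of_null_compl volume_compl_image_add_inv] at this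
  simpa only [det_restrictScalars_toSpanSingleton, abs_pow, abs_norm] using this

/-- The Chebyshev polynomial `S n`, weighted by the power of the root height which makes the
family with `n < N` orthogonal in `L²(ℂ)`. -/
noncomputable def weightedChebyshev (N n : ℕ) (β : ℂ) : ℂ :=
  ((rootHeight β ^ (N + 1))⁻¹ : ℝ) * (Chebyshev.S ℂ n).eval β

/-- In the coordinate `γ` the product of two weighted Chebyshev polynomials is a combination of
four monomials in `γ` and its conjugate. -/
theorem weightedChebyshev_comp_add_inv (N n m : ℕ) {γ : ℂ} (hγ : γ ∈ unitDiscExterior) :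
    ‖1 - (γ ^ 2)⁻¹‖ ^ 2 • (weightedChebyshev N n (γ + γ⁻¹) *
        conj (weightedChebyshev N m (γ + γ⁻¹))) =
      (‖γ‖ : ℂ) ^ (-(2 * N + 4) : ℤ) * (γ ^ (n + 1 : ℤ) * conj γ ^ (m + 1 : ℤ)) -
      (‖γ‖ : ℂ) ^ (-(2 * N + 4) : ℤ) * (γ ^ (n + 1 : ℤ) * conj γ ^ (-(m + 1) : ℤ)) -
      ((‖γ‖ : ℂ) ^ (-(2 * N + 4) : ℤ) * (γ ^ (-(n + 1) : ℤ) * conj γ ^ (m + 1 : ℤ)) -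
      (‖γ‖ : ℂ) ^ (-(2 * N + 4) : ℤ) * (γ ^ (-(n + 1) : ℤ) * conj γ ^ (-(m + 1) : ℤ))) := by
  have h0 := ne_zero_of_mem_unitDiscExterior hγ
  have hn0 : (‖γ‖ : ℂ) ≠ 0 := by exact_mod_cast norm_ne_zero_iff.2 h0
  have hS := eval_chebyshev_S h0 n
  have hT := congrArg conj (eval_chebyshev_S h0 m)
  -- The Jacobian supplies exactly the denominators `γ - γ⁻¹` of the two Chebyshev polynomials.
  have hJ : ((‖1 - (γ ^ 2)⁻¹‖ ^ 2 : ℝ) : ℂ) =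
      (‖γ‖ : ℂ) ^ (-2 : ℤ) * ((γ - γ⁻¹) * conj (γ - γ⁻¹)) := by
    have : 1 - (γ ^ 2)⁻¹ = γ⁻¹ * (γ - γ⁻¹) := by field_simp
    rw [this, Complex.mul_conj', norm_mul, norm_inv]
    push_cast
    rw [mul_pow, zpow_neg, inv_pow]; rfl
  have hw : (((rootHeight (γ + γ⁻¹) ^ (N + 1))⁻¹ : ℝ) : ℂ) = (‖γ‖ : ℂ) ^ (-(N + 1) : ℤ) := by
    rw [rootHeight_add_inv hγ, zpow_neg]; push_cast; norm_cast
  have hexp : (‖γ‖ : ℂ) ^ (-(2 * N + 4) : ℤ) =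
      (‖γ‖ : ℂ) ^ (-2 : ℤ) * (‖γ‖ : ℂ) ^ (-(N + 1) : ℤ) * (‖γ‖ : ℂ) ^ (-(N + 1) : ℤ) := by
    rw [← zpow_add₀ hn0, ← zpow_add₀ hn0]; congr 1; ring
  have hp : ∀ (z : ℂ) (k : ℕ), z ^ (k + 1 : ℤ) = z ^ (k + 1) := fun z k => by norm_cast
  have hq : ∀ (z : ℂ) (k : ℕ), z ^ (-(k + 1) : ℤ) = z⁻¹ ^ (k + 1) := fun z k => by
    rw [zpow_neg, hp, inv_pow]
  rw [Complex.real_smul, hJ, weightedChebyshev, weightedChebyshev, map_mul, Complex.conj_ofReal, hw]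
  rw [map_mul] at hT
  rw [hexp]
  generalize (‖γ‖ : ℂ) ^ (-(N + 1) : ℤ) = w
  simp only [hp, hq]
  simp only [map_sub, map_pow, map_inv₀] at hT ⊢
  linear_combination ((‖γ‖ : ℂ) ^ (-2 : ℤ) * w * w) * ((conj γ - (conj γ)⁻¹) *
      conj ((Chebyshev.S ℂ m).eval (γ + γ⁻¹)) * hS + (γ ^ (n + 1) - γ⁻¹ ^ (n + 1)) * hT)

theorem integrable_weightedChebyshev_mul {N n m : ℕ} (hn : n < N) (hm : m < N) :
    Integrable fun β => weightedChebyshev N n β * conj (weightedChebyshev N m β) := by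
  rw [integrable_iff_comp_add_inv]
  refine IntegrableOn.congr_fun ?_ (fun γ hγ => (weightedChebyshev_comp_add_inv N n m hγ).symm)
    measurableSet_unitDiscExterior
  exact ((integrableOn_unitDiscExterior N (by omega)).sub
    (integrableOn_unitDiscExterior N (by omega))).sub
    ((integrableOn_unitDiscExterior N (by omega)).sub
    (integrableOn_unitDiscExterior N (by omega)))

/-- The squared `L²` norm of the weighted Chebyshev polynomial `S n` for `n < N`, with
`(N+1)² - (n+1)²` written as `(N - n)(N + n + 2)`. -/
noncomputable def chebyshevNormSq (N n : ℕ) : ℝ :=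
  2 * Real.pi * (N + 1) / ((N - n) * (N + n + 2))

/-- Only the two diagonal moments survive: `π/(N-n) + π/(N+n+2)`. -/
theorem integral_weightedChebyshev_mul {N n m : ℕ} (hn : n < N) (hm : m < N) :
    ∫ β, weightedChebyshev N n β * conj (weightedChebyshev N m β) =
      if n = m then (chebyshevNormSq N n : ℂ) else 0 := by
  rw [integral_eq_integral_comp_add_inv, setIntegral_congr_fun measurableSet_unitDiscExterior
    (fun γ hγ => weightedChebyshev_comp_add_inv N n m hγ)]
  have i1 := integrableOn_unitDiscExterior N (a := n + 1) (b := m + 1) (by omega)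
  have i2 := integrableOn_unitDiscExterior N (a := n + 1) (b := -(m + 1)) (by omega)
  have i3 := integrableOn_unitDiscExterior N (a := -(n + 1)) (b := m + 1) (by omega)
  have i4 := integrableOn_unitDiscExterior N (a := -(n + 1)) (b := -(m + 1)) (by omega)
  have e1 := integral_unitDiscExterior N (a := n + 1) (b := m + 1) (by omega)
  have e2 := integral_unitDiscExterior N (a := n + 1) (b := -(m + 1)) (by omega)
  have e3 := integral_unitDiscExterior N (a := -(n + 1)) (b := m + 1) (by omega)
  have e4 := integral_unitDiscExterior N (a := -(n + 1)) (b := -(m + 1)) (by omega)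
  rw [if_neg (by omega)] at e2 e3
  rw [integral_sub (i1.fun_sub i2) (i3.fun_sub i4), integral_sub i1 i2, integral_sub i3 i4,
    e1, e2, e3, e4]
  by_cases h : n = m
  · subst h
    simp only [if_true, chebyshevNormSq]
    push_cast
    have h1 : (N : ℂ) - n ≠ 0 := sub_ne_zero.2 (by exact_mod_cast hn.ne')
    have h2 : (N : ℂ) + n + 2 ≠ 0 := by exact_mod_cast (by omega : N + n + 2 ≠ 0)
    rw [show (N : ℂ) + 1 - (n + 1) = N - n by ring,
      show (N : ℂ) + 1 - -(n + 1) = N + n + 2 by ring]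
    field_simp
    ring
  · rw [if_neg (by omega), if_neg (by omega), if_neg h]
    simp

/-! ### The integral over monic polynomials -/

/-- In root coordinates the integral becomes that of `|det V|² ∏ rootHeight(βᵢ)^(-2(N+1))`.
Column operations replace the monomials of the Vandermonde determinant by Chebyshev polynomials,
which are orthogonal for this weight, so Andréief's identity applies. -/
theorem lintegral_inv_monicHeight_pow (N : ℕ) :
    ∫⁻ b : Fin N → ℂ, ENNReal.ofReal ((monicHeight b ^ (2 * N + 2))⁻¹) =
      ENNReal.ofReal (∏ j : Fin N, chebyshevNormSq N j) := by
  have hfac : (N.factorial : ENNReal) ≠ 0 := by exact_mod_cast N.factorial_ne_zero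
  have h := factorial_mul_lintegral_eq_lintegral_roots (N := N)
    fun b => ENNReal.ofReal ((monicHeight b ^ (2 * N + 2))⁻¹)
  have hA := lintegral_norm_det_sq (N := N) (μ := volume)
    (fun k => weightedChebyshev N k) (fun j => chebyshevNormSq N j)
    (fun j k => integrable_weightedChebyshev_mul j.2 k.2)
    (fun j k => by simp only [integral_weightedChebyshev_mul j.2 k.2, Fin.val_inj])
  have hdet : ∀ β : Fin N → ℂ, ENNReal.ofReal (‖(Matrix.vandermonde β).det‖ ^ 2) *
      ENNReal.ofReal ((monicHeight (coeffsOfRoots β) ^ (2 * N + 2))⁻¹) =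
      ENNReal.ofReal (‖(Matrix.of fun i (k : Fin N) => weightedChebyshev N k (β i)).det‖ ^ 2) := by
    intro β
    have h1 := Matrix.det_mul_column
      (fun i => (((rootHeight (β i) ^ (N + 1))⁻¹ : ℝ) : ℂ))
      (Matrix.of fun i (k : Fin N) => (Chebyshev.S ℂ (k : ℕ)).eval (β i))
    rw [← Matrix.det_eval_matrixOfPolynomials_eq_det_vandermonde β
      (fun k : Fin N => Chebyshev.S ℂ (k : ℕ)) (fun k => (monic_chebyshev_S k).2)
      (fun k => (monic_chebyshev_S k).1)] at h1
    have h2 : ‖∏ i, (((rootHeight (β i) ^ (N + 1))⁻¹ : ℝ) : ℂ)‖ =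
        ((∏ i, rootHeight (β i)) ^ (N + 1))⁻¹ := by
      rw [norm_prod, ← Finset.prod_pow, ← Finset.prod_inv_distrib]
      refine Finset.prod_congr rfl fun i _ => ?_
      rw [Complex.norm_real, Real.norm_of_nonneg]
      have := rootHeight_pos (β i)
      positivity
    -- The weights are common factors of the rows.
    change _ = ENNReal.ofReal (‖(Matrix.of fun i (k : Fin N) =>
      (((rootHeight (β i) ^ (N + 1))⁻¹ : ℝ) : ℂ) * _).det‖ ^ 2)
    erw [h1]
    rw [norm_mul, h2, monicHeight_coeffsOfRoots, ← ENNReal.ofReal_mul (by positivity)]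
    congr 1
    rw [mul_pow, inv_pow, ← pow_mul, mul_comm]
    congr 3
    ring
  simp only [hdet] at h
  rw [← volume_pi] at hA
  rw [hA, ENNReal.ofReal_mul (by positivity), ENNReal.ofReal_natCast] at h
  exact (ENNReal.mul_right_inj hfac (ENNReal.natCast_ne_top _)).1 h

/-! ### Leading coefficient and volume -/

/-- The monic polynomials `P₀ = 1` and, for `n ≥ 1`, the Chebyshev polynomials with
`Pₙ(x + x⁻¹) = xⁿ + x⁻ⁿ`. The constant term is not the Chebyshev polynomial of index `0`, which
is `2`. -/
noncomputable def chebyshevBasis (N : ℕ) : Fin (N + 1) → ℂ[X] :=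
  Fin.cases 1 fun n => Chebyshev.C ℂ ((n : ℕ) + 1)

theorem monic_chebyshevBasis (N : ℕ) (k : Fin (N + 1)) :
    (chebyshevBasis N k).Monic ∧ (chebyshevBasis N k).natDegree = k := by
  refine Fin.cases ?_ (fun n => ?_) k
  · simp [chebyshevBasis]
  · simpa [chebyshevBasis] using monic_chebyshev_C n

/-- The unipotent matrix whose columns are the coefficients of the polynomials
`chebyshevBasis N`. -/
noncomputable def chebyshevMatrix (N : ℕ) : Matrix (Fin (N + 1)) (Fin (N + 1)) ℂ :=
  Matrix.of fun i j => (chebyshevBasis N j).coeff i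

theorem det_chebyshevMatrix (N : ℕ) : (chebyshevMatrix N).det = 1 :=
  Matrix.det_matrixOfPolynomials _ (fun k => (monic_chebyshevBasis N k).2)
    fun k => (monic_chebyshevBasis N k).1

/-- The reciprocal Mahler measure of `q(x + x⁻¹)` for `q = ∑ c_k X^k`. -/
noncomputable def coeffHeight {N : ℕ} (c : Fin (N + 1) → ℂ) : ℝ :=
  (joukowskiLift N (∑ k : Fin (N + 1), C (c k) * X ^ (k : ℕ))).mahlerMeasure

theorem coeff_sum_C_mul_X_pow {N : ℕ} (c : Fin N → ℂ) (k : Fin N) :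
    (∑ k : Fin N, C (c k) * X ^ (k : ℕ)).coeff k = c k := by
  simp only [finsetSum_coeff, coeff_C_mul, coeff_X_pow, Fin.val_inj]
  simp

theorem joukowskiLift_congr {N : ℕ} {p q : ℂ[X]} (h : ∀ k : Fin (N + 1), p.coeff k = q.coeff k) :
    joukowskiLift N p = joukowskiLift N q :=
  Finset.sum_congr rfl fun k hk => by rw [h ⟨k, Finset.mem_range.1 hk⟩]

theorem recMahlerMeasure_eq_coeffHeight {N : ℕ} (v : Fin (N + 1) → ℂ) :
    recMahlerMeasure v = coeffHeight ((chebyshevMatrix N).mulVec v) := by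
  have hlift : joukowskiLift N (∑ k : Fin (N + 1),
      C ((chebyshevMatrix N).mulVec v k) * X ^ (k : ℕ)) =
      joukowskiLift N (∑ k, C (v k) * chebyshevBasis N k) := by
    refine joukowskiLift_congr fun k => ?_
    rw [coeff_sum_C_mul_X_pow]
    simp [Matrix.mulVec, dotProduct, chebyshevMatrix, mul_comm]
  rw [coeffHeight, hlift, ← mahlerMeasure_recPoly]
  congr 1
  refine eq_of_eval_eq_of_ne_zero fun x hx => ?_
  have hdeg : (∑ k, C (v k) * chebyshevBasis N k).natDegree ≤ N :=
    natDegree_sum_le_of_forall_le _ _ fun k _ => (natDegree_C_mul_le _ _).trans (by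
      rw [(monic_chebyshevBasis N k).2]; omega)
  rw [eval_recPoly v hx, eval_joukowskiLift hdeg hx]
  congr 1
  rw [eval_finsetSum, Fin.sum_univ_succ, recLaurent]
  simp only [eval_mul, eval_C, chebyshevBasis, Fin.cases_zero, Fin.cases_succ, mul_one]
  congr 1
  refine Finset.sum_congr rfl fun n _ => ?_
  have := eval_chebyshev_C hx (n + 1)
  push_cast at this
  rw [this]

/-- Measurability is transported from `recMahlerMeasure` through the inverse of the coordinate
change. -/
theorem measurable_coeffHeight (N : ℕ) :
    Measurable (coeffHeight : (Fin (N + 1) → ℂ) → ℝ) := by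
  have h : (coeffHeight : (Fin (N + 1) → ℂ) → ℝ) =
      fun c => recMahlerMeasure ((chebyshevMatrix N)⁻¹.mulVec c) := by
    funext c
    rw [recMahlerMeasure_eq_coeffHeight, Matrix.mulVec_mulVec, Matrix.mul_nonsing_inv,
      Matrix.one_mulVec]
    rw [det_chebyshevMatrix]; exact isUnit_one
  rw [h]
  refine (measurable_recMahlerMeasure N).comp ?_
  unfold Matrix.mulVec dotProduct
  fun_prop

theorem coeffHeight_insertNth {N : ℕ} (a : ℂ) (b : Fin N → ℂ) :
    coeffHeight (Fin.insertNth (α := fun _ => ℂ) (Fin.last N) a (a • b)) = ‖a‖ * monicHeight b := by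
  rw [coeffHeight, monicHeight, ← mahlerMeasure_const a, ← mahlerMeasure_mul, ← joukowskiLift_C_mul]
  refine congrArg mahlerMeasure (joukowskiLift_congr fun k => ?_)
  rw [coeff_sum_C_mul_X_pow, coeff_C_mul]
  rw [Fin.insertNth_last']
  rcases Fin.eq_castSucc_or_eq_last k with ⟨k, rfl⟩ | rfl
  · rw [Fin.snoc_castSucc, Fin.val_castSucc, coeff_monicOfCoeffs]
    rfl
  · have := (monic_monicOfCoeffs b).coeff_natDegree
    rw [natDegree_monicOfCoeffs] at this
    rw [Fin.snoc_last, Fin.val_last, this, mul_one]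

theorem measurable_insertNth_last (N : ℕ) :
    Measurable fun p : ℂ × (Fin N → ℂ) => Fin.insertNth (α := fun _ => ℂ) (Fin.last N) p.1 p.2 :=
  (MeasurableEquiv.piFinSuccAbove (fun _ => ℂ) (Fin.last N)).symm.measurable

theorem measurable_monicHeight (N : ℕ) : Measurable (monicHeight : (Fin N → ℂ) → ℝ) := by
  have h : (monicHeight : (Fin N → ℂ) → ℝ) =
      fun b => coeffHeight (Fin.insertNth (α := fun _ => ℂ) (Fin.last N) 1 b) := by
    funext b
    simpa using (coeffHeight_insertNth 1 b).symm
  rw [h]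
  exact (measurable_coeffHeight N).comp
    ((measurable_insertNth_last N).comp (measurable_const.prodMk measurable_id))

/-- The linear change of coordinates `chebyshevMatrix` preserves volume. -/
theorem volume_recStarBody_eq_volume_coeffHeight_le (N : ℕ) :
    volume (recStarBody N) = volume {c : Fin (N + 1) → ℂ | coeffHeight c ≤ 1} := by
  have hdet : LinearMap.det ((Matrix.toLin' (chebyshevMatrix N)).restrictScalars ℝ) = 1 := by
    rw [det_restrictScalars_toLin', det_chebyshevMatrix]; simp
  have h := Measure.addHaar_preimage_linearMap (volume : Measure (Fin (N + 1) → ℂ))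
    (f := (Matrix.toLin' (chebyshevMatrix N)).restrictScalars ℝ) (by rw [hdet]; exact one_ne_zero)
    {c | coeffHeight c ≤ 1}
  rw [hdet, inv_one, abs_one, ENNReal.ofReal_one, one_mul] at h
  rw [← h]
  congr 1
  ext v
  simp [recStarBody, recMahlerMeasure_eq_coeffHeight]

/-- Multiplication by `a` on `ℂ^N` has real determinant `|a|^(2N)`. -/
theorem volume_preimage_complex_smul {N : ℕ} {a : ℂ} (ha : a ≠ 0) (s : Set (Fin N → ℂ)) :
    volume s = ENNReal.ofReal (‖a‖ ^ (2 * N)) * volume ((fun b => a • b) ⁻¹' s) := by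
  have hdet : LinearMap.det ((Matrix.toLin' (Matrix.diagonal fun _ : Fin N => a)).restrictScalars ℝ)
      = ‖a‖ ^ (2 * N) := by
    rw [det_restrictScalars_toLin', Matrix.det_diagonal, Finset.prod_const, Finset.card_univ,
      Fintype.card_fin, norm_pow, ← pow_mul, mul_comm]
  have hpos : 0 < ‖a‖ ^ (2 * N) := pow_pos (norm_pos_iff.2 ha) _
  have h := Measure.addHaar_preimage_linearMap (volume : Measure (Fin N → ℂ))
    (f := (Matrix.toLin' (Matrix.diagonal fun _ : Fin N => a)).restrictScalars ℝ)
    (by rw [hdet]; exact hpos.ne') s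
  have hs : (fun b => a • b) ⁻¹' s =
      ((Matrix.toLin' (Matrix.diagonal fun _ : Fin N => a)).restrictScalars ℝ) ⁻¹' s := by
    ext b
    have : (Matrix.diagonal fun _ : Fin N => a).mulVec b = a • b := by
      ext i; simp [Matrix.mulVec_diagonal]
    simp [this]
  rw [hs, h, hdet, ← mul_assoc, ← ENNReal.ofReal_mul hpos.le, abs_of_pos (inv_pos.2 hpos),
    mul_inv_cancel₀ hpos.ne', ENNReal.ofReal_one, one_mul]

theorem setLIntegral_closedBall_norm_pow (N : ℕ) {R : ℝ} (hR : 0 < R) :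
    ∫⁻ a in Metric.closedBall (0 : ℂ) R, ENNReal.ofReal (‖a‖ ^ (2 * N)) =
      ENNReal.ofReal (Real.pi / (N + 1) * R ^ (2 * N + 2)) := by
  have hint : IntegrableOn (fun a : ℂ => ‖a‖ ^ (2 * N)) (Metric.closedBall 0 R) :=
    (continuous_norm.pow _).continuousOn.integrableOn_compact (isCompact_closedBall 0 R)
  rw [← ofReal_integral_eq_lintegral_ofReal hint (ae_of_all _ fun a => by positivity)]
  congr 1
  have hind : (Metric.closedBall (0 : ℂ) R).indicator (fun a : ℂ => ‖a‖ ^ (2 * N)) =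
      fun a => (Set.Iic R).indicator (fun r => r ^ (2 * N)) ‖a‖ := by
    ext a
    simp [Set.indicator]
  rw [← integral_indicator Metric.isClosed_closedBall.measurableSet, hind,
    integral_fun_norm_addHaar volume ((Set.Iic R).indicator fun r => r ^ (2 * N)),
    Complex.finrank_real_complex]
  have hrad : ∫ y in Set.Ioi (0 : ℝ), y ^ (2 - 1) • (Set.Iic R).indicator (fun r => r ^ (2 * N)) y =
      R ^ (2 * N + 2) / (2 * N + 2) := by
    have : ∀ y : ℝ, y ^ (2 - 1) • (Set.Iic R).indicator (fun r => r ^ (2 * N)) y =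
        (Set.Iic R).indicator (fun r => r ^ (2 * N + 1)) y := fun y => by
      by_cases h : y ≤ R
      · rw [Set.indicator_of_mem (Set.mem_Iic.2 h), Set.indicator_of_mem (Set.mem_Iic.2 h),
          smul_eq_mul]
        ring
      · rw [Set.indicator_of_notMem (mt Set.mem_Iic.1 h),
          Set.indicator_of_notMem (mt Set.mem_Iic.1 h), smul_zero]
    simp only [this]
    rw [setIntegral_indicator measurableSet_Iic, Set.Ioi_inter_Iic,
      ← intervalIntegral.integral_of_le hR.le, integral_pow]
    push_cast
    ring
  rw [hrad, measureReal_def, Complex.volume_ball]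
  simp
  field_simp

/-- Writing the coefficients as `(a b, a)`, where `a` is the leading one, the condition becomes
`|a| monicHeight b ≤ 1`. Integrating `|a|^(2N)` over this disc first gives
`π/(N+1) (monicHeight b)^(-2(N+1))`. -/
theorem volume_coeffHeight_le (N : ℕ) :
    volume {c : Fin (N + 1) → ℂ | coeffHeight c ≤ 1} =
      ENNReal.ofReal (Real.pi / (N + 1)) * ENNReal.ofReal (∏ j : Fin N, chebyshevNormSq N j) := by
  have hmS : MeasurableSet {c : Fin (N + 1) → ℂ | coeffHeight c ≤ 1} :=
    measurableSet_le (measurable_coeffHeight N) measurable_const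
  have hmp := (volume_preserving_piFinSuccAbove (fun _ => ℂ) (Fin.last N)).symm
  rw [← hmp.measure_preimage hmS.nullMeasurableSet, Measure.volume_eq_prod,
    Measure.prod_apply (hmp.measurable hmS)]
  -- For `a ≠ 0` the slice over `a` is the dilation by `a` of `{b | ‖a‖ * monicHeight b ≤ 1}`.
  have hslice : ∀ a : ℂ, a ≠ 0 → volume (Prod.mk a ⁻¹'
      ((MeasurableEquiv.piFinSuccAbove (fun _ => ℂ) (Fin.last N)).symm ⁻¹'
        {c : Fin (N + 1) → ℂ | coeffHeight c ≤ 1})) =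
      ∫⁻ b : Fin N → ℂ, (Metric.closedBall (0 : ℂ) (monicHeight b)⁻¹).indicator
        (fun a => ENNReal.ofReal (‖a‖ ^ (2 * N))) a := by
    intro a ha
    have hset : (fun b : Fin N → ℂ => a • b) ⁻¹' (Prod.mk a ⁻¹'
        ((MeasurableEquiv.piFinSuccAbove (fun _ => ℂ) (Fin.last N)).symm ⁻¹'
          {c : Fin (N + 1) → ℂ | coeffHeight c ≤ 1})) = {b | ‖a‖ * monicHeight b ≤ 1} := by
      ext b
      change coeffHeight (Fin.insertNth (α := fun _ => ℂ) (Fin.last N) a (a • b)) ≤ 1 ↔ _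
      rw [coeffHeight_insertNth]; rfl
    have hmb : MeasurableSet {b : Fin N → ℂ | ‖a‖ * monicHeight b ≤ 1} :=
      measurableSet_le ((measurable_monicHeight N).const_mul _) measurable_const
    rw [volume_preimage_complex_smul ha, hset, ← lintegral_indicator_const hmb]
    refine lintegral_congr fun b => ?_
    have hiff : b ∈ {b : Fin N → ℂ | ‖a‖ * monicHeight b ≤ 1} ↔
        a ∈ Metric.closedBall (0 : ℂ) (monicHeight b)⁻¹ := by
      rw [mem_closedBall_zero_iff, ← one_div, le_div_iff₀ (monicHeight_pos b)]
      rfl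
    by_cases h : b ∈ {b : Fin N → ℂ | ‖a‖ * monicHeight b ≤ 1}
    · rw [Set.indicator_of_mem h, Set.indicator_of_mem (hiff.1 h)]
    · rw [Set.indicator_of_notMem h, Set.indicator_of_notMem (mt hiff.2 h)]
  have hmeas : Measurable (Function.uncurry fun (a : ℂ) (b : Fin N → ℂ) =>
      (Metric.closedBall (0 : ℂ) (monicHeight b)⁻¹).indicator
        (fun a => ENNReal.ofReal (‖a‖ ^ (2 * N))) a) := by
    have hset : MeasurableSet {p : ℂ × (Fin N → ℂ) | ‖p.1‖ ≤ (monicHeight p.2)⁻¹} :=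
      measurableSet_le measurable_fst.norm ((measurable_monicHeight N).comp measurable_snd).inv
    have hf : Measurable fun p : ℂ × (Fin N → ℂ) => ENNReal.ofReal (‖p.1‖ ^ (2 * N)) := by
      fun_prop
    convert hf.indicator hset using 1
    ext p
    simp [Function.uncurry, Set.indicator]
  rw [lintegral_congr_ae ((Measure.ae_ne volume (0 : ℂ)).mono hslice),
    lintegral_lintegral_swap hmeas.aemeasurable, ← lintegral_inv_monicHeight_pow,
    ← lintegral_const_mul' _ _ ENNReal.ofReal_ne_top]
  refine lintegral_congr fun b => ?_
  rw [lintegral_indicator Metric.isClosed_closedBall.measurableSet,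
    setLIntegral_closedBall_norm_pow N (inv_pos.2 (monicHeight_pos b)), inv_pow,
    ← ENNReal.ofReal_mul (by positivity)]

theorem prod_chebyshevNormSq (N : ℕ) :
    Real.pi / (N + 1) * ∏ j : Fin N, chebyshevNormSq N j =
      (2 : ℝ) ^ N * Real.pi ^ (N + 1) * ((N : ℝ) + 1) ^ N / ((2 * N + 1).factorial : ℝ) := by
  have h1 : ∏ j ∈ Finset.range N, ((N : ℝ) - j) = N.factorial := by
    rw [← Finset.prod_range_reflect, ← Finset.prod_range_add_one_eq_factorial]
    push_cast
    refine Finset.prod_congr rfl fun j hj => ?_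
    have := Finset.mem_range.1 hj
    rw [Nat.cast_sub (by omega), Nat.cast_sub (by omega)]
    push_cast; ring
  have h2 : ((N + 1).factorial : ℝ) * ∏ j ∈ Finset.range N, ((N : ℝ) + j + 2) =
      (2 * N + 1).factorial := by
    have := Nat.factorial_mul_ascFactorial (N + 1) N
    rw [Nat.ascFactorial_eq_prod_range, show N + 1 + N = 2 * N + 1 by ring] at this
    rw [← this]
    push_cast
    congr 1
    refine Finset.prod_congr rfl fun j _ => by ring
  have hN : (N.factorial : ℝ) ≠ 0 := by exact_mod_cast N.factorial_ne_zero
  have hN2 : ((2 * N + 1).factorial : ℝ) ≠ 0 := by exact_mod_cast (2 * N + 1).factorial_ne_zero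
  have hP : ∏ j ∈ Finset.range N, ((N : ℝ) + j + 2) ≠ 0 := by
    intro h; rw [h, mul_zero] at h2; exact hN2 h2.symm
  rw [← Finset.prod_range fun j => chebyshevNormSq N j]
  simp only [chebyshevNormSq, Finset.prod_div_distrib, Finset.prod_mul_distrib, Finset.prod_const,
    Finset.card_range, h1]
  rw [← h2, Nat.factorial_succ]
  push_cast
  field_simp
  ring

theorem volume_recStarBody (N : ℕ) :
    volume (recStarBody N) = ENNReal.ofReal
      ((2 : ℝ) ^ N * Real.pi ^ (N + 1) * ((N : ℝ) + 1) ^ N / ((2 * N + 1).factorial : ℝ)) := by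
  rw [volume_recStarBody_eq_volume_coeffHeight_le, volume_coeffHeight_le,
    ← ENNReal.ofReal_mul (by positivity), prod_chebyshevNormSq]

theorem mainTheorem3 (N : ℕ) (hN : 1 ≤ N) :
    MeasurableSet (recStarBody N) ∧
    volume (recStarBody N) =
      ENNReal.ofReal
        ((2 : ℝ) ^ N * Real.pi ^ (N + 1) * ((N : ℝ) + 1) ^ N / ((2 * N + 1).factorial : ℝ)) ∧
    ∃ (q : ℚ) (k : ℕ), 0 < q ∧
      volume (reciprocalCoords N '' {f ∈ reciprocalPolynomials N | f.mahlerMeasure ≤ 1}) =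
        ENNReal.ofReal ((q : ℝ) * Real.pi ^ k) := by
  refine ⟨measurableSet_le (measurable_recMahlerMeasure N) measurable_const, volume_recStarBody N,
    2 ^ N * (N + 1) ^ N / (2 * N + 1).factorial, N + 1, by positivity, ?_⟩
  rw [image_reciprocalCoords_eq, volume_recStarBody]
  congr 1
  push_cast
  ring
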